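/- Consider randomized adaptive algorithms that know $n$ and $\varepsilon$ and have query access to an unknown function $f\colon\mathbb R^n\to\mathbb R$ and sample access to an unknown Borel probability distribution $\mathcal D$ on $\mathbb R^n$. For a property $\mathcal P$ (a set of functions $\mathbb R^n\to\mathbb R$) put $\delta_{\mathcal D}(f,\mathcal P)=\inf_{g\in\mathcal P}\Pr_{p\sim\mathcal D}[f(p)\neq g(p)]$. A distribution-free tester for $\mathcal P$ with proximity parameter $\varepsilon$ accepts every $f\in\mathcal P$ with probability at least $2/3$ and rejects every $f$ with $\delta_{\mathcal D}(f,\mathcal P)>\varepsilon$ with probability at least $2/3$, for every $\mathcal D$; it has one-sided error if it accepts every $f\in\mathcal P$ with probability $1$. Theorem. There are absolute constants $N,K,C$ such that for all $n$ and all $\varepsilon\in(0,1)$ the tester described below makes at most $C/\varepsilon$ queries to $f$, and it is 1. a one-sided error distribution-free tester, for (Borel) measurable $f\colon\mathbb R^n\to\mathbb R$, of additivity, i.e. of the property of being a measurable function with $g(x)+g(y)=g(x+y)$ for all $x,y$; 2. a one-sided error distribution-free tester, for continuous $f\colon\mathbb R^n\to\mathbb R$, of linearity, i.e. of the property $g(x)=\sum_{i=1}^n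 c_ix_i$ for some $c_1,\dots,c_n\in\mathbb R$. Tester. First, $N$ times: draw independent standard Gaussian vectors $x,y,z\sim\mathcal N(0,I)$ and reject if $f(-x)\ne -f(x)$, or $f(x-y)\neq f(x)-f(y)$, or $f\big(\tfrac{x-y}{\sqrt2}\big)\neq f\big(\tfrac{x-z}{\sqrt2}\big)+f\big(\tfrac{z-y}{\sqrt2}\big)$. Then, $\lceil K/\varepsilon\rceil$ times: draw $p\sim\mathcal D$ and a single Gaussian direction $x\sim\mathcal N(0,I)$, and reject if $f(p)\ne\kappa_p\big(f(p/\kappa_p-x)+f(x)\big)$, where $\kappa_p=1$ if $\|p\|_2\le 1/50$ and $\kappa_p=50\|p\|_2$ otherwise. If nothing was rejected, accept. -/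

import Mathlib

open MeasureTheory ProbabilityTheory
open scoped ENNReal

noncomputable section

/-- `ℝⁿ` with the Euclidean norm. -/
abbrev RealSpace (n : ℕ) : Type := EuclideanSpace ℝ (Fin n)

/-! ### Randomized adaptive algorithms with query access and sample access -/

/-- A randomized adaptive algorithm which has query access to an unknown function `f : ℝⁿ → ℝ`,
sample access to an unknown distribution `D` on `ℝⁿ`, can draw standard Gaussian vectors in `ℝⁿ`
as its internal randomness, and finally outputs an element of `α`. The next step may depend on all
the answers received so far (and on nothing else: neither on `f` nor on `D` directly). -/
inductive QueryAlg (n : ℕ) (α : Type) : Type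
  /-- stop and output `a` -/
  | output (a : α) : QueryAlg n α
  /-- query the function at the point `x` and continue with the answer -/
  | query (x : RealSpace n) (next : ℝ → QueryAlg n α) : QueryAlg n α
  /-- draw a fresh sample from the unknown distribution `D` -/
  | sample (next : RealSpace n → QueryAlg n α) : QueryAlg n α
  /-- draw a fresh standard Gaussian vector -/
  | gaussian (next : RealSpace n → QueryAlg n α) : QueryAlg n α

namespace QueryAlg

variable {n : ℕ} {α β : Type}

/-- Sequential composition: run the first algorithm, then continue with its output. -/
def andThen : QueryAlg n α → (α → QueryAlg n β) → QueryAlg n β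
  | output a, k => k a
  | query x next, k => query x fun y => andThen (next y) k
  | sample next, k => sample fun p => andThen (next p) k
  | gaussian next, k => gaussian fun x => andThen (next x) k

instance : Monad (QueryAlg n) where
  pure := output
  bind := andThen

/-- Ask for the value of the unknown function at `x`. -/
def ask (x : RealSpace n) : QueryAlg n ℝ := query x output

/-- A sample from the unknown distribution. -/
def drawSample : QueryAlg n (RealSpace n) := sample output

/-- A standard Gaussian vector `x ∼ N(0, I)`. -/
def drawGaussian : QueryAlg n (RealSpace n) := gaussian output

open Classical in
/-- The probability that the output is `b`, when queries are answered by `f`, samples are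
drawn (independently) from `D`, and the Gaussian vectors are drawn independently of everything. -/
def prob (f : RealSpace n → ℝ) (D : Measure (RealSpace n)) (b : α) : QueryAlg n α → ℝ≥0∞
  | output a => if a = b then 1 else 0
  | query x next => prob f D b (next (f x))
  | sample next => ∫⁻ p, prob f D b (next p) ∂D
  | gaussian next => ∫⁻ x, prob f D b (next x) ∂(stdGaussian (RealSpace n))

/-- The worst-case number of queries to the function (over all answers, samples and random
choices). -/
def queryComplexity : QueryAlg n α → ℕ∞
  | output _ => 0
  | query _ next => 1 + ⨆ y, queryComplexity (next y)
  | sample next => ⨆ p, queryComplexity (next p)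
  | gaussian next => ⨆ x, queryComplexity (next x)

end QueryAlg

/-! ### Properties, distance, and testers -/

/-- Additive (measurable) functions on `ℝⁿ`. -/
def additiveFunctions (n : ℕ) : Set (RealSpace n → ℝ) :=
  {g | Measurable g ∧ ∀ x y, g x + g y = g (x + y)}

/-- Linear functions on `ℝⁿ`. -/
def linearFunctions (n : ℕ) : Set (RealSpace n → ℝ) :=
  {g | ∃ c : Fin n → ℝ, ∀ x, g x = ∑ i, c i * x i}

/-- `δ_D(f, P) = inf_{g ∈ P} Pr_{x ∼ D}[f x ≠ g x]`. -/
def distToProperty {n : ℕ} (D : Measure (RealSpace n)) (f : RealSpace n → ℝ)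
    (P : Set (RealSpace n → ℝ)) : ℝ≥0∞ :=
  ⨅ g ∈ P, D {x | f x ≠ g x}

/-- `T` (with output `true` for "accept" and `false` for "reject") is a distribution-free tester
with proximity parameter `ε` for the property `P` of functions from the class `F`. -/
structure IsDistributionFreeTester {n : ℕ} (T : QueryAlg n Bool) (F P : Set (RealSpace n → ℝ))
    (ε : ℝ) : Prop where
  complete : ∀ (D : Measure (RealSpace n)) [IsProbabilityMeasure D], ∀ f ∈ F, f ∈ P →
    2 / 3 ≤ T.prob f D true
  sound : ∀ (D : Measure (RealSpace n)) [IsProbabilityMeasure D], ∀ f ∈ F,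
    ENNReal.ofReal ε < distToProperty D f P → 2 / 3 ≤ T.prob f D false

/-- The tester accepts every function (from the class `F`) with the property `P` with
probability one. -/
def HasOneSidedError {n : ℕ} (T : QueryAlg n Bool) (F P : Set (RealSpace n → ℝ)) : Prop :=
  ∀ (D : Measure (RealSpace n)) [IsProbabilityMeasure D], ∀ f ∈ F, f ∈ P → T.prob f D true = 1

/-! ### The tester that evaluates the self-corrected function with one Gaussian direction -/

section Algorithm

open QueryAlg

variable {n : ℕ}

/-- The radial contraction factor: `p / κ_p` lies in the ball of radius `1/50`. -/
def contractionFactor (p : RealSpace n) : ℝ :=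
  if ‖p‖ ≤ 1 / 50 then 1 else 50 * ‖p‖

/-- Evaluation of the self-corrected function at `p` with a single Gaussian direction `x`: the
output is `g_x(p) = κ_p (f(p / κ_p - x) + f(x))`. -/
def queryG (p : RealSpace n) : QueryAlg n ℝ := do
  let x ← drawGaussian
  let u ← ask ((contractionFactor p)⁻¹ • p - x)
  let v ← ask x
  return contractionFactor p * (u + v)

/-- Run `T` independently up to `k` times; reject as soon as one of the runs rejects. -/
def repeatTest (T : QueryAlg n Bool) : ℕ → QueryAlg n Bool
  | 0 => return true
  | k + 1 => do
    let b ← T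
    if b then repeatTest T k else return false

open Classical in
/-- One round of the additivity subroutine. -/
def additivityRound : QueryAlg n Bool := do
  let x ← drawGaussian
  let y ← drawGaussian
  let z ← drawGaussian
  let fnx ← ask (-x)
  let fx ← ask x
  if fnx ≠ -fx then return false else
    let fxy ← ask (x - y)
    let fy ← ask y
    if fxy ≠ fx - fy then return false else
      let a ← ask ((√2)⁻¹ • (x - y))
      let b ← ask ((√2)⁻¹ • (x - z))
      let c ← ask ((√2)⁻¹ • (z - y))
      if a ≠ b + c then return false else return true

open Classical in
/-- One comparison of `f` with its self-correction at a random point `p ∼ D`. -/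
def correctionRound : QueryAlg n Bool := do
  let p ← drawSample
  let w ← ask p
  let v ← queryG p
  if w ≠ v then return false else return true

/-- The tester: `N` rounds of the additivity subroutine, followed by `M` comparisons of `f` with
its self-correction. -/
def singleDirectionTester (n N M : ℕ) : QueryAlg n Bool := do
  let b ← repeatTest additivityRound N
  if b then repeatTest correctionRound M else return false

end Algorithm

end

/-! Completeness: a measurable additive function is a continuous linear functional, and such a
functional passes every check identically.

Soundness: suppose one additivity round rejects with probability at most 1/100. For a short vector
p, the law of x ↦ p - x under the standard Gaussian is within 1/25 of the Gaussian itself, whatever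
the dimension (`map_const_sub_stdGaussian_apply_le`). Hence identities that hold for most Gaussian
points still hold for most reflected and slightly shifted ones. The difference test then shows that
f(p - x) + f(x) takes one value h(p) for at least 9/10 of the x (`exists_concentrated`). The test
with √2 shows that h is additive on the ball of radius 1/50 (`concentrated_add`). A measurable f is
bounded off a set of small Gaussian measure, so h is bounded on this ball
(`exists_bound_concentrated`). Additive and bounded on a ball, h is there the restriction of a
continuous linear L (`exists_continuousLinearMap_eq_of_additive_on_ball`).

A single random direction x therefore computes L(p/κ_p), and by scaling L(p), correctly with
probability at least 9/10. No majority vote is needed: at every p with f(p) ≠ L(p) one comparison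
rejects with probability at least 1/2 (`le_prob_false_correctionRound`). If f is ε-far from the
property, such p have D-mass at least ε, so O(1/ε) comparisons suffice. If instead an additivity
round rejects with probability at least 1/100, then a constant number of these rounds suffices. -/

noncomputable section

/-! ### Shifts of Gaussian measures -/

/-- Comparison of the densities of `N(c, 1)` and `N(0, 1)`, in the form used for bounding the
total variation distance by the chi-square divergence. -/
lemma gaussianPDFReal_sub_le (c x : ℝ) {δ : ℝ} (hδ : 0 < δ) :
    gaussianPDFReal c 1 x - gaussianPDFReal 0 1 x ≤
      (2 * δ)⁻¹ * (Real.exp (c ^ 2) * gaussianPDFReal (2 * c) 1 x - 2 * gaussianPDFReal c 1 x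
        + gaussianPDFReal 0 1 x) + δ / 2 * gaussianPDFReal 0 1 x ∧
    0 ≤ (2 * δ)⁻¹ * (Real.exp (c ^ 2) * gaussianPDFReal (2 * c) 1 x - 2 * gaussianPDFReal c 1 x
        + gaussianPDFReal 0 1 x) + δ / 2 * gaussianPDFReal 0 1 x := by
  set L := Real.exp (c * x - c ^ 2 / 2) with hL
  set g := gaussianPDFReal 0 1 x with hg
  have h0 : 0 ≤ g := gaussianPDFReal_nonneg _ _ _
  have h1 : gaussianPDFReal c 1 x = L * g := by
    simp only [hg, hL, gaussianPDFReal, NNReal.coe_one]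
    rw [mul_left_comm, ← Real.exp_add]
    congr 2
    ring
  have h2 : Real.exp (c ^ 2) * gaussianPDFReal (2 * c) 1 x = L ^ 2 * g := by
    simp only [hg, hL, gaussianPDFReal, NNReal.coe_one]
    rw [mul_left_comm, ← Real.exp_add, mul_left_comm, ← Real.exp_nat_mul, ← Real.exp_add]
    congr 2
    push_cast
    ring
  rw [h1, h2]
  -- AM-GM for the likelihood ratio L, with δ as the free weight. After integration the quadratic
  -- term becomes the chi-square divergence, so no Cauchy-Schwarz inequality is needed.
  have key : L - 1 ≤ (2 * δ)⁻¹ * (L - 1) ^ 2 + δ / 2 := by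
    have : (2 * δ)⁻¹ * (L - 1) ^ 2 + δ / 2 - (L - 1) = (2 * δ)⁻¹ * (L - 1 - δ) ^ 2 := by
      field_simp
      ring
    have h3 : 0 ≤ (2 * δ)⁻¹ * (L - 1 - δ) ^ 2 := by positivity
    linarith
  have e : (2 * δ)⁻¹ * (L ^ 2 * g - 2 * (L * g) + g) + δ / 2 * g
      = ((2 * δ)⁻¹ * (L - 1) ^ 2 + δ / 2) * g := by ring
  rw [e]
  exact ⟨by nlinarith [mul_le_mul_of_nonneg_right key h0], by positivity⟩

/-- With δ = 1/25, the majorant integrates over the line to (exp(c²) - 1)/(2δ) + δ/2, which is at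
most 0.0125 + 0.02 < 1/25. The range 3/100 leaves room for shifts by √2 · p with ‖p‖ ≤ 1/50. -/
lemma gaussianReal_shift_le {c : ℝ} (hc : |c| ≤ 3 / 100) (A : Set ℝ) :
    gaussianReal c 1 A ≤ gaussianReal 0 1 A + ENNReal.ofReal (1 / 25) := by
  rw [gaussianReal_apply_eq_integral _ one_ne_zero, gaussianReal_apply_eq_integral _ one_ne_zero,
    ← ENNReal.ofReal_add (integral_nonneg fun _ => gaussianPDFReal_nonneg _ _ _) (by norm_num)]
  apply ENNReal.ofReal_le_ofReal
  have hi := fun m : ℝ => integrable_gaussianPDFReal m 1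
  have h1 := fun m : ℝ => integral_gaussianPDFReal_eq_one m (one_ne_zero (α := NNReal))
  set R : ℝ → ℝ := fun x => (2 * (1 / 25 : ℝ))⁻¹ * (Real.exp (c ^ 2) * gaussianPDFReal (2 * c) 1 x
    - 2 * gaussianPDFReal c 1 x + gaussianPDFReal 0 1 x) + (1 / 25) / 2 * gaussianPDFReal 0 1 x
    with hR
  have hb := fun x => gaussianPDFReal_sub_le c x (δ := 1 / 25) (by norm_num)
  have i1 := (hi (2 * c)).const_mul (Real.exp (c ^ 2))
  have i2 := (hi c).const_mul 2
  have hRi : Integrable R :=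
    ((((i1.sub i2).add (hi 0)).const_mul _).add ((hi 0).const_mul _))
  have hRv : ∫ x, R x = (2 * (1 / 25 : ℝ))⁻¹ * (Real.exp (c ^ 2) - 2 + 1) + (1 / 25) / 2 := by
    have j1 : Integrable (fun x => Real.exp (c ^ 2) * gaussianPDFReal (2 * c) 1 x
      - 2 * gaussianPDFReal c 1 x) := i1.sub i2
    have j2 : Integrable (fun x => Real.exp (c ^ 2) * gaussianPDFReal (2 * c) 1 x
      - 2 * gaussianPDFReal c 1 x + gaussianPDFReal 0 1 x) := j1.add (hi 0)
    rw [hR, integral_add (j2.const_mul _) ((hi 0).const_mul _), integral_const_mul,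
      integral_add j1 (hi 0), integral_sub i1 i2, integral_const_mul, integral_const_mul,
      integral_const_mul, h1, h1, h1]
    ring
  -- The majorant is nonnegative, so its integral over `A` may be enlarged to the whole line; this
  -- gives a bound uniform in `A`.
  have hsub : (∫ x in A, gaussianPDFReal c 1 x) - ∫ x in A, gaussianPDFReal 0 1 x ≤ ∫ x, R x := by
    rw [← integral_sub (hi c).integrableOn (hi 0).integrableOn]
    refine (setIntegral_mono ((hi c).sub (hi 0)).integrableOn hRi.integrableOn
      fun x => (hb x).1).trans ?_
    exact setIntegral_le_integral hRi (Filter.Eventually.of_forall fun x => (hb x).2)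
  have hexp : Real.exp (c ^ 2) ≤ 1 + 1 / 1000 := by
    have hc2 : c ^ 2 ≤ 9 / 10000 := by
      rw [← sq_abs]
      nlinarith [abs_nonneg c]
    have := Real.abs_exp_sub_one_sub_id_le (x := c ^ 2) (by rw [abs_of_nonneg (sq_nonneg c)]; linarith)
    rw [abs_le] at this
    nlinarith [sq_nonneg c]
  rw [hRv] at hsub
  linarith

/-! ### Standard Gaussians on a Euclidean space: resampling, small shifts, normalized differences.
-/

section StdGaussian

variable {E : Type*} [NormedAddCommGroup E] [InnerProductSpace ℝ E] [FiniteDimensional ℝ E]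
  [MeasurableSpace E] [BorelSpace E]

/-- A standard Gaussian vector can be resampled along a unit vector `e`. -/
lemma map_resample_stdGaussian {e : E} (he : ‖e‖ = 1) :
    ((gaussianReal 0 1).prod (stdGaussian E)).map
      (fun z : ℝ × E => z.2 - inner ℝ e z.2 • e + z.1 • e) = stdGaussian E := by
  have hm : Measurable (fun z : ℝ × E => z.2 - inner ℝ e z.2 • e + z.1 • e) := by fun_prop
  have : IsProbabilityMeasure (((gaussianReal 0 1).prod (stdGaussian E)).map
      (fun z : ℝ × E => z.2 - inner ℝ e z.2 • e + z.1 • e)) :=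
    Measure.isProbabilityMeasure_map hm.aemeasurable
  apply Measure.ext_of_charFun
  ext t
  rw [charFun_stdGaussian, charFun_apply, integral_map hm.aemeasurable (by fun_prop)]
  -- The character at t factors into the coordinate along e and the part of t orthogonal to e;
  -- Pythagoras recombines the two Gaussian exponents.
  have hsplit : ∀ z : ℝ × E,
      Complex.exp ((inner ℝ (z.2 - inner ℝ e z.2 • e + z.1 • e) t : ℝ) * Complex.I) =
      Complex.exp (((inner ℝ e t : ℝ) : ℂ) * (z.1 : ℂ) * Complex.I) *
      Complex.exp ((inner ℝ z.2 (t - (inner ℝ e t : ℝ) • e) : ℝ) * Complex.I) := by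
    intro z
    rw [← Complex.exp_add]
    congr 1
    rw [← add_mul]
    congr 1
    rw [← Complex.ofReal_mul, ← Complex.ofReal_add]
    congr 1
    simp only [inner_add_left, inner_sub_left, inner_sub_right, inner_smul_left, inner_smul_right,
      real_inner_comm e z.2, conj_trivial]
    ring
  simp_rw [hsplit]
  rw [integral_prod_mul (fun s : ℝ => Complex.exp (((inner ℝ e t : ℝ) : ℂ) * (s : ℂ) * Complex.I))
    (fun y : E => Complex.exp ((inner ℝ y (t - (inner ℝ e t : ℝ) • e) : ℝ) * Complex.I)),
    ← charFun_apply_real, ← charFun_apply, charFun_stdGaussian, charFun_gaussianReal,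
    ← Complex.exp_add]
  congr 1
  have hn : ‖t - (inner ℝ e t : ℝ) • e‖ ^ 2 = ‖t‖ ^ 2 - inner ℝ e t ^ 2 := by
    rw [norm_sub_sq_real, norm_smul, inner_smul_right, he, real_inner_comm, Real.norm_eq_abs,
      mul_one, sq_abs]
    ring
  rw [← Complex.ofReal_pow ‖_‖, hn]
  push_cast
  ring

/-- If each of two probability measures changes by at most `δ` (resp. `δ'`), then so does the
product, by at most `δ + δ'`. -/
lemma prod_apply_le_add {X Y : Type*} [MeasurableSpace X] [MeasurableSpace Y]
    {μ μ' : Measure X} {ν ν' : Measure Y} [IsProbabilityMeasure μ] [IsProbabilityMeasure μ']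
    [IsProbabilityMeasure ν] [IsProbabilityMeasure ν'] {δ δ' : ℝ≥0∞}
    (h : ∀ A, MeasurableSet A → μ' A ≤ μ A + δ) (h' : ∀ A, MeasurableSet A → ν' A ≤ ν A + δ')
    {A : Set (X × Y)} (hA : MeasurableSet A) :
    (μ'.prod ν') A ≤ (μ.prod ν) A + (δ + δ') := by
  have h1 : (μ'.prod ν') A ≤ (μ'.prod ν) A + δ' := by
    rw [Measure.prod_apply hA, Measure.prod_apply hA]
    calc ∫⁻ x, ν' (Prod.mk x ⁻¹' A) ∂μ' ≤ ∫⁻ x, (ν (Prod.mk x ⁻¹' A) + δ') ∂μ' :=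
          lintegral_mono fun x => h' _ (measurable_prodMk_left hA)
      _ = _ := by rw [lintegral_add_right _ measurable_const]; simp
  have h2 : (μ'.prod ν) A ≤ (μ.prod ν) A + δ := by
    rw [Measure.prod_apply_symm hA, Measure.prod_apply_symm hA]
    calc ∫⁻ y, μ' ((fun x => (x, y)) ⁻¹' A) ∂ν ≤ ∫⁻ y, (μ ((fun x => (x, y)) ⁻¹' A) + δ) ∂ν :=
          lintegral_mono fun x => h _ (measurable_prodMk_right hA)
      _ = _ := by rw [lintegral_add_right _ measurable_const]; simp
  calc _ ≤ _ := h1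
    _ ≤ (μ.prod ν) A + δ + δ' := by gcongr
    _ = _ := add_assoc _ _ _

/-- Resampling along the direction of p makes the shift act on one real Gaussian coordinate only, so
the one-dimensional bound applies with no loss in the dimension. -/
lemma stdGaussian_preimage_add_le {p : E} (hp : ‖p‖ ≤ 3 / 100) {A : Set E}
    (hA : MeasurableSet A) :
    stdGaussian E ((fun x => x + p) ⁻¹' A) ≤ stdGaussian E A + ENNReal.ofReal (1 / 25) := by
  rcases eq_or_ne p 0 with rfl | hp0
  · simp
  set e := ‖p‖⁻¹ • p with he
  have hn : ‖p‖ ≠ 0 := norm_ne_zero_iff.2 hp0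
  have he1 : ‖e‖ = 1 := by
    rw [he, norm_smul, norm_inv, norm_norm, inv_mul_cancel₀ hn]
  have hpe : p = ‖p‖ • e := by rw [he, smul_smul, mul_inv_cancel₀ hn, one_smul]
  set φ := fun z : ℝ × E => z.2 - inner ℝ e z.2 • e + z.1 • e with hφ
  have hm : Measurable φ := by fun_prop
  have hadd : Measurable (fun x : E => x + p) := by fun_prop
  have hmap := map_resample_stdGaussian he1
  have hg : (gaussianReal 0 1).map (fun s => s + ‖p‖) = gaussianReal ‖p‖ 1 := by
    rw [gaussianReal_map_add_const, zero_add]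
  calc stdGaussian E ((fun x => x + p) ⁻¹' A)
      = ((gaussianReal 0 1).prod (stdGaussian E)) (φ ⁻¹' ((fun x => x + p) ⁻¹' A)) := by
        rw [← Measure.map_apply hm (hadd hA), hmap]
    _ = ((gaussianReal 0 1).prod (stdGaussian E)) (Prod.map (fun s => s + ‖p‖) id ⁻¹' (φ ⁻¹' A)) := by
        congr 1
        ext z
        simp only [Set.mem_preimage, hφ, Prod.map_fst, Prod.map_snd, id, add_smul, ← hpe, add_assoc]
    _ = ((gaussianReal ‖p‖ 1).prod (stdGaussian E)) (φ ⁻¹' A) := by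
        rw [← Measure.map_apply (by fun_prop) (hm hA),
          ← Measure.map_prod_map _ _ (by fun_prop) measurable_id, hg, Measure.map_id]
    _ ≤ ((gaussianReal 0 1).prod (stdGaussian E)) (φ ⁻¹' A) + (ENNReal.ofReal (1 / 25) + 0) :=
        prod_apply_le_add (fun B _ => gaussianReal_shift_le (by rwa [abs_norm]) B)
          (fun B _ => by simp) (hm hA)
    _ = _ := by rw [← Measure.map_apply hm hA, hmap, add_zero]

lemma map_neg_stdGaussian : (stdGaussian E).map (fun x => -x) = stdGaussian E :=
  stdGaussian_map (LinearIsometryEquiv.neg ℝ (E := E))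

lemma map_const_sub_stdGaussian_apply_le {p : E} (hp : ‖p‖ ≤ 3 / 100) {A : Set E}
    (hA : MeasurableSet A) :
    (stdGaussian E).map (fun x => p - x) A ≤ stdGaussian E A + ENNReal.ofReal (1 / 25) := by
  have h : (fun x : E => p - x) = (fun x => x + p) ∘ fun x => -x := by
    ext x
    simp [sub_eq_neg_add]
  rw [h, ← Measure.map_map (by fun_prop) (by fun_prop), map_neg_stdGaussian,
    Measure.map_apply (by fun_prop) hA]
  exact stdGaussian_preimage_add_le hp hA

/-- The normalized difference of two independent standard Gaussians is a standard Gaussian. -/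
lemma map_sub_stdGaussian :
    ((stdGaussian E).prod (stdGaussian E)).map (fun z : E × E => (√2)⁻¹ • (z.1 - z.2)) =
      stdGaussian E := by
  have hm : Measurable (fun z : E × E => (√2)⁻¹ • (z.1 - z.2)) := by fun_prop
  have : IsProbabilityMeasure (((stdGaussian E).prod (stdGaussian E)).map
      (fun z : E × E => (√2)⁻¹ • (z.1 - z.2))) := Measure.isProbabilityMeasure_map hm.aemeasurable
  apply Measure.ext_of_charFun
  ext t
  rw [charFun_stdGaussian, charFun_apply, integral_map hm.aemeasurable (by fun_prop)]
  have hsplit : ∀ z : E × E,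
      Complex.exp ((inner ℝ ((√2)⁻¹ • (z.1 - z.2)) t : ℝ) * Complex.I) =
      Complex.exp ((inner ℝ z.1 ((√2)⁻¹ • t) : ℝ) * Complex.I) *
      Complex.exp ((inner ℝ z.2 (-((√2)⁻¹ • t)) : ℝ) * Complex.I) := by
    intro z
    rw [← Complex.exp_add, ← add_mul, ← Complex.ofReal_add]
    congr 3
    simp only [inner_sub_left, inner_smul_left, inner_smul_right, inner_neg_right, conj_trivial]
    ring
  simp_rw [hsplit]
  rw [integral_prod_mul (fun y : E => Complex.exp ((inner ℝ y ((√2)⁻¹ • t) : ℝ) * Complex.I))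
    (fun y : E => Complex.exp ((inner ℝ y (-((√2)⁻¹ • t)) : ℝ) * Complex.I)),
    ← charFun_apply, ← charFun_apply, charFun_stdGaussian, charFun_stdGaussian, ← Complex.exp_add]
  congr 1
  have hn : ‖(√2)⁻¹ • t‖ ^ 2 = ‖t‖ ^ 2 / 2 := by
    rw [norm_smul, mul_pow, norm_inv, Real.norm_of_nonneg (Real.sqrt_nonneg 2), inv_pow,
      Real.sq_sqrt zero_le_two]
    ring
  rw [norm_neg, ← Complex.ofReal_pow, hn]
  push_cast
  ring

end StdGaussian

/-! ### Output probabilities and query complexity of composed algorithms -/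

namespace QueryAlg

variable {n : ℕ}

lemma bind_eq {α β : Type} (T : QueryAlg n α) (k : α → QueryAlg n β) : T >>= k = T.andThen k := rfl

lemma pure_eq {α : Type} (a : α) : (pure a : QueryAlg n α) = output a := rfl

/-- All conditional output probabilities of the algorithm are measurable functions of the samples
and of the Gaussian vectors drawn so far. -/
def IsMeasurable (f : RealSpace n → ℝ) (D : Measure (RealSpace n)) : QueryAlg n Bool → Prop
  | output _ => True
  | query x next => IsMeasurable f D (next (f x))
  | sample next => (∀ p, IsMeasurable f D (next p)) ∧ ∀ b, Measurable fun p => prob f D b (next p)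
  | gaussian next => (∀ x, IsMeasurable f D (next x)) ∧ ∀ b, Measurable fun x => prob f D b (next x)

variable {f : RealSpace n → ℝ} {D : Measure (RealSpace n)}

/-- The law of total probability over the two outcomes of `T`. Measurability is what makes
`lintegral` additive at the random nodes. -/
lemma prob_andThen (b : Bool) (k : Bool → QueryAlg n Bool) (T : QueryAlg n Bool)
    (hT : T.IsMeasurable f D) :
    prob f D b (T.andThen k) =
      prob f D true T * prob f D b (k true) + prob f D false T * prob f D b (k false) := by
  induction T with
  | output a => cases a <;> simp [andThen, prob]
  | query x next ih => exact ih _ hT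
  | sample next ih =>
    simp only [andThen, prob]
    rw [← lintegral_mul_const _ (hT.2 true), ← lintegral_mul_const _ (hT.2 false),
      ← lintegral_add_left ((hT.2 true).mul_const _)]
    exact lintegral_congr fun p => ih p (hT.1 p)
  | gaussian next ih =>
    simp only [andThen, prob]
    rw [← lintegral_mul_const _ (hT.2 true), ← lintegral_mul_const _ (hT.2 false),
      ← lintegral_add_left ((hT.2 true).mul_const _)]
    exact lintegral_congr fun p => ih p (hT.1 p)

lemma IsMeasurable.andThen {T : QueryAlg n Bool} {k : Bool → QueryAlg n Bool}
    (hT : T.IsMeasurable f D) (hk : ∀ b, (k b).IsMeasurable f D) :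
    (T.andThen k).IsMeasurable f D := by
  induction T with
  | output a => exact hk a
  | query x next ih => exact ih _ hT
  | sample next ih =>
    refine ⟨fun p => ih p (hT.1 p), fun b => ?_⟩
    simp_rw [fun p => prob_andThen b k _ (hT.1 p)]
    exact ((hT.2 true).mul_const _).add ((hT.2 false).mul_const _)
  | gaussian next ih =>
    refine ⟨fun p => ih p (hT.1 p), fun b => ?_⟩
    simp_rw [fun p => prob_andThen b k _ (hT.1 p)]
    exact ((hT.2 true).mul_const _).add ((hT.2 false).mul_const _)

lemma prob_true_add_prob_false [IsProbabilityMeasure D] (T : QueryAlg n Bool)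
    (hT : T.IsMeasurable f D) : prob f D true T + prob f D false T = 1 := by
  induction T with
  | output a => cases a <;> simp [prob]
  | query x next ih => exact ih _ hT
  | sample next ih =>
    simp only [prob]
    rw [← lintegral_add_left (hT.2 true), lintegral_congr fun p => ih p (hT.1 p)]
    simp
  | gaussian next ih =>
    simp only [prob]
    rw [← lintegral_add_left (hT.2 true), lintegral_congr fun p => ih p (hT.1 p)]
    simp

lemma repeatTest_succ (T : QueryAlg n Bool) (k : ℕ) :
    repeatTest T (k + 1) = T.andThen fun b => if b then repeatTest T k else output false := rfl

lemma IsMeasurable.repeatTest {T : QueryAlg n Bool} (hT : T.IsMeasurable f D) (k : ℕ) :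
    (repeatTest T k).IsMeasurable f D := by
  induction k with
  | zero => trivial
  | succ k ih => exact hT.andThen fun b => by cases b <;> [trivial; exact ih]

lemma prob_true_repeatTest {T : QueryAlg n Bool} (hT : T.IsMeasurable f D) (k : ℕ) :
    prob f D true (repeatTest T k) = prob f D true T ^ k := by
  induction k with
  | zero => simp [_root_.repeatTest, pure_eq, prob]
  | succ k ih =>
    rw [repeatTest_succ, prob_andThen _ _ _ hT, pow_succ']
    simp [ih, prob]

lemma singleDirectionTester_eq (N M : ℕ) :
    singleDirectionTester n N M = (repeatTest additivityRound N).andThen fun b =>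
      if b then repeatTest correctionRound M else output false := rfl

lemma IsMeasurable.singleDirectionTester (ha : (additivityRound (n := n)).IsMeasurable f D)
    (hc : (correctionRound (n := n)).IsMeasurable f D) (N M : ℕ) :
    (singleDirectionTester n N M).IsMeasurable f D :=
  (ha.repeatTest N).andThen fun b => by cases b <;> [trivial; exact hc.repeatTest M]

lemma prob_true_singleDirectionTester (ha : (additivityRound (n := n)).IsMeasurable f D)
    (hc : (correctionRound (n := n)).IsMeasurable f D) (N M : ℕ) :
    prob f D true (singleDirectionTester n N M) =
      prob f D true (additivityRound (n := n)) ^ N *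
        prob f D true (correctionRound (n := n)) ^ M := by
  rw [singleDirectionTester_eq, prob_andThen _ _ _ (ha.repeatTest N)]
  simp [prob_true_repeatTest ha, prob_true_repeatTest hc, prob]

/-! ### Worst-case query counts. -/

lemma queryComplexity_andThen_le {α β : Type} {T : QueryAlg n α} {k : α → QueryAlg n β} {c : ℕ∞}
    (hk : ∀ a, (k a).queryComplexity ≤ c) :
    (T.andThen k).queryComplexity ≤ T.queryComplexity + c := by
  induction T with
  | output a => simpa [andThen, queryComplexity] using hk a
  | query x next ih =>
    simp only [andThen, queryComplexity, add_assoc]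
    gcongr
    exact iSup_le fun y => (ih y).trans (by gcongr; exact le_iSup (fun y => (next y).queryComplexity) y)
  | sample next ih =>
    exact iSup_le fun y => (ih y).trans (by
      gcongr; exact le_iSup (fun y => (next y).queryComplexity) y)
  | gaussian next ih =>
    exact iSup_le fun y => (ih y).trans (by
      gcongr; exact le_iSup (fun y => (next y).queryComplexity) y)

lemma queryComplexity_repeatTest_le {T : QueryAlg n Bool} {c : ℕ}
    (hT : T.queryComplexity ≤ c) (k : ℕ) : (repeatTest T k).queryComplexity ≤ (c * k : ℕ) := by
  induction k with
  | zero => simp [repeatTest, pure_eq, queryComplexity]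
  | succ k ih =>
    rw [repeatTest_succ]
    refine (queryComplexity_andThen_le (c := (c * k : ℕ)) fun b => ?_).trans ?_
    · cases b
      · simp [queryComplexity]
      · exact ih
    · rw [mul_add, mul_one, add_comm, Nat.cast_add]
      gcongr

lemma queryComplexity_query_le {α : Type} {x : RealSpace n} {next : ℝ → QueryAlg n α} {c : ℕ}
    (h : ∀ y, (next y).queryComplexity ≤ c) : (query x next).queryComplexity ≤ (c + 1 : ℕ) := by
  simp only [queryComplexity]
  rw [Nat.cast_add, Nat.cast_one, add_comm]
  gcongr
  exact iSup_le h

open Classical in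
lemma additivityRound_eq : additivityRound (n := n) =
    gaussian fun x => gaussian fun y => gaussian fun z => query (-x) fun fnx => query x fun fx =>
      if fnx ≠ -fx then output false else query (x - y) fun fxy => query y fun fy =>
        if fxy ≠ fx - fy then output false else query ((√2)⁻¹ • (x - y)) fun a =>
          query ((√2)⁻¹ • (x - z)) fun b => query ((√2)⁻¹ • (z - y)) fun c =>
            if a ≠ b + c then output false else output true := by
  rw [additivityRound]
  simp only [bind_eq, drawGaussian, ask, andThen, pure_eq]

open Classical in
lemma correctionRound_eq : correctionRound (n := n) =
    sample fun p => query p fun w => gaussian fun x =>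
      query ((contractionFactor p)⁻¹ • p - x) fun u => query x fun v =>
        if w ≠ contractionFactor p * (u + v) then output false else output true := rfl

lemma queryComplexity_additivityRound_le : (additivityRound (n := n)).queryComplexity ≤ (7 : ℕ) := by
  classical
  rw [additivityRound_eq]
  refine iSup_le fun x => iSup_le fun y => iSup_le fun z =>
    queryComplexity_query_le (c := 6) fun _ => queryComplexity_query_le (c := 5) fun _ => ?_
  split_ifs
  · simp [queryComplexity]
  refine queryComplexity_query_le (c := 4) fun _ => queryComplexity_query_le (c := 3) fun _ => ?_
  split_ifs
  · simp [queryComplexity]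
  refine queryComplexity_query_le (c := 2) fun _ => queryComplexity_query_le (c := 1) fun _ =>
    queryComplexity_query_le (c := 0) fun _ => ?_
  split_ifs <;> simp [queryComplexity]

lemma queryComplexity_correctionRound_le : (correctionRound (n := n)).queryComplexity ≤ (3 : ℕ) := by
  classical
  rw [correctionRound_eq]
  refine iSup_le fun p => queryComplexity_query_le (c := 2) fun _ => iSup_le fun x =>
    queryComplexity_query_le (c := 1) fun _ => queryComplexity_query_le (c := 0) fun _ => ?_
  split_ifs <;> simp [queryComplexity]

lemma queryComplexity_singleDirectionTester_le (N M : ℕ) :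
    (singleDirectionTester n N M).queryComplexity ≤ (7 * N + 3 * M : ℕ) := by
  rw [singleDirectionTester_eq, Nat.cast_add]
  refine (queryComplexity_andThen_le (c := (3 * M : ℕ)) fun b => ?_).trans ?_
  · cases b
    · simp [queryComplexity]
    · exact queryComplexity_repeatTest_le queryComplexity_correctionRound_le M
  · gcongr
    exact queryComplexity_repeatTest_le queryComplexity_additivityRound_le N

/-! ### Acceptance events of the two kinds of rounds, and their probabilities. -/

/-- The triples of Gaussian vectors for which a round of the additivity subroutine accepts. -/
def additivityGood (f : RealSpace n → ℝ) : Set (RealSpace n × RealSpace n × RealSpace n) :=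
  {w | f (-w.1) = -f w.1 ∧ f (w.1 - w.2.1) = f w.1 - f w.2.1 ∧
    f ((√2)⁻¹ • (w.1 - w.2.1)) = f ((√2)⁻¹ • (w.1 - w.2.2)) + f ((√2)⁻¹ • (w.2.2 - w.2.1))}

/-- The pairs of a sample and a Gaussian direction for which a comparison round accepts. -/
def correctionGood (f : RealSpace n → ℝ) : Set (RealSpace n × RealSpace n) :=
  {w | f w.1 =
    contractionFactor w.1 * (f ((contractionFactor w.1)⁻¹ • w.1 - w.2) + f w.2)}

lemma measurableSet_additivityGood (hf : Measurable f) : MeasurableSet (additivityGood f) := by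
  refine (measurableSet_eq_fun (by fun_prop) (by fun_prop)).inter
    ((measurableSet_eq_fun (by fun_prop) (by fun_prop)).inter
      (measurableSet_eq_fun (by fun_prop) (by fun_prop)))

lemma measurable_contractionFactor : Measurable (contractionFactor (n := n)) := by
  unfold contractionFactor
  exact Measurable.ite (measurableSet_le (by fun_prop) (by fun_prop)) (by fun_prop) (by fun_prop)

lemma measurableSet_correctionGood (hf : Measurable f) : MeasurableSet (correctionGood f) := by
  have := measurable_contractionFactor (n := n)
  exact measurableSet_eq_fun (by fun_prop) (by fun_prop)

/-- The probability of the output `b` of an algorithm which accepts if and only if `w ∈ S`. -/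
def decisionProb {X : Type*} (S : Set X) (b : Bool) (w : X) : ℝ≥0∞ :=
  if b then S.indicator 1 w else Sᶜ.indicator 1 w

lemma measurable_decisionProb {X : Type*} [MeasurableSpace X] {S : Set X} (hS : MeasurableSet S)
    (b : Bool) : Measurable (decisionProb S b) := by
  cases b
  · exact measurable_one.indicator hS.compl
  · exact measurable_one.indicator hS

lemma lintegral_decisionProb_false {X : Type*} [MeasurableSpace X] {S : Set X}
    (hS : MeasurableSet S) (μ : Measure X) : ∫⁻ w, decisionProb S false w ∂μ = μ Sᶜ :=
  lintegral_indicator_one hS.compl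

open Classical in
/-- The queries of a round of the additivity subroutine. -/
def additivityQueries (x y z : RealSpace n) : QueryAlg n Bool :=
  query (-x) fun fnx => query x fun fx =>
    if fnx ≠ -fx then output false else query (x - y) fun fxy => query y fun fy =>
      if fxy ≠ fx - fy then output false else query ((√2)⁻¹ • (x - y)) fun a =>
        query ((√2)⁻¹ • (x - z)) fun b => query ((√2)⁻¹ • (z - y)) fun c =>
          if a ≠ b + c then output false else output true

lemma prob_additivityQueries (b : Bool) (x y z : RealSpace n) :
    prob f D b (additivityQueries x y z) = decisionProb (additivityGood f) b (x, y, z) := by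
  classical
  by_cases h1 : f (-x) = -f x <;> by_cases h2 : f (x - y) = f x - f y <;>
    by_cases h3 : f ((√2)⁻¹ • (x - y)) = f ((√2)⁻¹ • (x - z)) + f ((√2)⁻¹ • (z - y)) <;>
    cases b <;> simp [additivityQueries, prob, decisionProb, additivityGood, h1, h2, h3]

lemma isMeasurable_additivityQueries (x y z : RealSpace n) :
    (additivityQueries x y z).IsMeasurable f D := by
  classical
  simp only [additivityQueries, IsMeasurable]
  split_ifs
  · trivial
  simp only [IsMeasurable]
  split_ifs
  · trivial
  simp only [IsMeasurable]
  split_ifs <;> trivial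

lemma isMeasurable_additivityRound (hf : Measurable f) :
    (additivityRound (n := n)).IsMeasurable f D := by
  classical
  rw [additivityRound_eq]
  have hφ := fun b => measurable_decisionProb (measurableSet_additivityGood hf) b
  refine ⟨fun x => ⟨fun y => ⟨fun z => isMeasurable_additivityQueries x y z, fun b => ?_⟩,
    fun b => ?_⟩, fun b => ?_⟩
  · change Measurable fun z => prob f D b (additivityQueries x y z)
    simp_rw [prob_additivityQueries]
    exact (hφ b).comp (by fun_prop)
  · change Measurable fun y => ∫⁻ z, prob f D b (additivityQueries x y z) ∂(stdGaussian (RealSpace n))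
    simp_rw [prob_additivityQueries]
    exact Measurable.lintegral_prod_right' ((hφ b).comp measurable_prodMk_left)
  · change Measurable fun x => ∫⁻ y, ∫⁻ z, prob f D b (additivityQueries x y z)
      ∂(stdGaussian (RealSpace n)) ∂(stdGaussian (RealSpace n))
    simp_rw [prob_additivityQueries]
    have h : Measurable fun w : (RealSpace n × RealSpace n) × RealSpace n =>
      decisionProb (additivityGood f) b (w.1.1, w.1.2, w.2) := (hφ b).comp (by fun_prop)
    exact Measurable.lintegral_prod_right' (f := fun w : RealSpace n × RealSpace n =>
      ∫⁻ z, decisionProb (additivityGood f) b (w.1, w.2, z) ∂(stdGaussian (RealSpace n)))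
      (Measurable.lintegral_prod_right' h)

lemma prob_false_additivityRound (hf : Measurable f) :
    prob f D false (additivityRound (n := n)) =
      ((stdGaussian (RealSpace n)).prod ((stdGaussian (RealSpace n)).prod
        (stdGaussian (RealSpace n)))) (additivityGood f)ᶜ := by
  classical
  have hφ := measurable_decisionProb (measurableSet_additivityGood hf) false
  rw [additivityRound_eq, ← lintegral_decisionProb_false (measurableSet_additivityGood hf),
    lintegral_prod _ hφ.aemeasurable]
  refine lintegral_congr fun x => ?_
  refine Eq.trans ?_ (lintegral_prod _ (hφ.comp measurable_prodMk_left).aemeasurable).symm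
  exact lintegral_congr fun y => lintegral_congr fun z => prob_additivityQueries false x y z

open Classical in
/-- The queries of a comparison round. -/
def correctionQueries (p : RealSpace n) : QueryAlg n Bool :=
  query p fun w => gaussian fun x =>
    query ((contractionFactor p)⁻¹ • p - x) fun u => query x fun v =>
      if w ≠ contractionFactor p * (u + v) then output false else output true

lemma prob_correctionQueries (b : Bool) (p : RealSpace n) :
    prob f D b (correctionQueries p) =
      ∫⁻ x, decisionProb (correctionGood f) b (p, x) ∂(stdGaussian (RealSpace n)) := by
  classical
  refine lintegral_congr fun x => ?_
  by_cases h : f p = contractionFactor p * (f ((contractionFactor p)⁻¹ • p - x) + f x) <;>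
    cases b <;> simp only [prob, decisionProb, correctionGood] <;> simp [h, prob]

lemma isMeasurable_correctionRound (hf : Measurable f) :
    (correctionRound (n := n)).IsMeasurable f D := by
  classical
  rw [correctionRound_eq]
  have hφ := fun b => measurable_decisionProb (measurableSet_correctionGood hf) b
  refine ⟨fun p => ⟨fun x => ?_, fun b => ?_⟩, fun b => ?_⟩
  · simp only [IsMeasurable]
    split_ifs <;> trivial
  · simp only [prob, apply_ite (prob f D b)]
    have := measurableSet_correctionGood hf
    exact Measurable.ite (((this.compl).preimage (measurable_prodMk_left (x := p))))
      measurable_const measurable_const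
  · change Measurable fun p => prob f D b (correctionQueries p)
    simp_rw [prob_correctionQueries]
    exact Measurable.lintegral_prod_right (hφ b)

lemma prob_false_correctionRound (hf : Measurable f) :
    prob f D false (correctionRound (n := n)) =
      ∫⁻ p, stdGaussian (RealSpace n) {x | f p ≠
        contractionFactor p * (f ((contractionFactor p)⁻¹ • p - x) + f x)} ∂D := by
  refine lintegral_congr fun p => (prob_correctionQueries false p).trans ?_
  exact lintegral_indicator_one
    ((measurableSet_correctionGood hf).compl.preimage (measurable_prodMk_left (x := p)))

end QueryAlg

/-! ### Self-correction -/

/-- A real function that is additive and bounded on a ball around `0` agrees there with a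
continuous linear functional. -/
lemma exists_continuousLinearMap_eq_of_additive_on_ball {E : Type*} [NormedAddCommGroup E]
    [NormedSpace ℝ E] {r : ℝ} (hr : 0 < r) {h : E → ℝ}
    (hadd : ∀ p q, ‖p‖ ≤ r → ‖q‖ ≤ r → ‖p + q‖ ≤ r → h (p + q) = h p + h q)
    {M : ℝ} (hM : ∀ p, ‖p‖ ≤ r → |h p| ≤ M) :
    ∃ L : E →L[ℝ] ℝ, ∀ p, ‖p‖ ≤ r → h p = L p := by
  have h0 : h 0 = 0 := by simpa [hr.le] using hadd 0 0
  have hnat : ∀ (m : ℕ) (p : E), ‖(m : ℝ) • p‖ ≤ r → ∀ j ≤ m, h ((j : ℝ) • p) = j * h p := by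
    intro m p hp j
    have hle : ∀ i ≤ m, ‖(i : ℝ) • p‖ ≤ r := by
      intro i hi
      refine le_trans ?_ hp
      rw [norm_smul, norm_smul]
      gcongr
      simpa using hi
    induction j with
    | zero => intro _; simp [h0]
    | succ j ih =>
      intro hj
      have e : ((j + 1 : ℕ) : ℝ) • p = (j : ℝ) • p + p := by push_cast; rw [add_smul, one_smul]
      rw [e, hadd _ _ (hle j (by omega)) (by simpa using hle 1 (by omega)) (by rw [← e]; exact hle _ hj),
        ih (by omega)]
      push_cast
      ring
  -- Passing through the common refinement m · k shows that k · h(p/k) does not depend on the scale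
  -- k, as long as p/k lies in the ball.
  have hdiv : ∀ (m k : ℕ) (p : E), 0 < m → 0 < k → ‖p‖ ≤ k * r →
      (m : ℝ) * k * h (((m : ℝ) * k)⁻¹ • p) = k * h ((k : ℝ)⁻¹ • p) := by
    intro m k p hm hk hp
    have hm' : (m : ℝ) ≠ 0 := by positivity
    have e : (k : ℝ)⁻¹ • p = (m : ℝ) • (((m : ℝ) * k)⁻¹ • p) := by
      rw [smul_smul]
      congr 1
      field_simp
    have hk' : ‖(k : ℝ)⁻¹ • p‖ ≤ r := by
      rw [norm_smul, norm_inv, RCLike.norm_natCast, inv_mul_le_iff₀ (by positivity)]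
      exact hp
    rw [e, hnat m _ (by rwa [← e]) m le_rfl]
    ring
  set k : E → ℕ := fun p => ⌈‖p‖ / r⌉₊ + 1 with hk
  have hkr : ∀ p, ‖p‖ ≤ k p * r := fun p => by
    rw [← div_le_iff₀ hr, hk]
    push_cast
    linarith [Nat.le_ceil (‖p‖ / r)]
  set G : E → ℝ := fun p => k p * h ((k p : ℝ)⁻¹ • p) with hG
  have hGm : ∀ (m : ℕ) p, 0 < m → ‖p‖ ≤ m * r → G p = m * h ((m : ℝ)⁻¹ • p) := by
    intro m p hm hp
    change (k p : ℝ) * h ((k p : ℝ)⁻¹ • p) = _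
    rw [← hdiv m (k p) p hm (Nat.succ_pos _) (hkr p), mul_comm (m : ℝ),
      hdiv (k p) m p (Nat.succ_pos _) hm hp]
  have hGh : ∀ p, ‖p‖ ≤ r → G p = h p := fun p hp => by
    simpa using hGm 1 p one_pos (by simpa using hp)
  have hGadd : ∀ p q, G (p + q) = G p + G q := by
    intro p q
    -- One scale that brings p, q and p + q into the ball simultaneously.
    set m := k p + k q + k (p + q) with hm
    have hm0 : 0 < m := by simp [hm, hk]
    have hle : ∀ v : E, k v ≤ m → ‖v‖ ≤ m * r := fun v hv =>
      (hkr v).trans (by gcongr)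
    have hball : ∀ v : E, ‖v‖ ≤ m * r → ‖(m : ℝ)⁻¹ • v‖ ≤ r := fun v hv => by
      rw [norm_smul, norm_inv, RCLike.norm_natCast, inv_mul_le_iff₀ (by positivity)]
      exact hv
    have h1 := hle p (by omega)
    have h2 := hle q (by omega)
    have h3 := hle (p + q) (by omega)
    rw [hGm m _ hm0 h1, hGm m _ hm0 h2, hGm m _ hm0 h3, smul_add,
      hadd _ _ (hball _ h1) (hball _ h2) (by rw [← smul_add]; exact hball _ h3)]
    ring
  set G' : E →+ ℝ := AddMonoidHom.mk' G hGadd with hG'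
  -- The bound on the ball excludes the discontinuous solutions of Cauchy's equation.
  have hcont : Continuous G' := by
    refine G'.continuous_of_isBounded_nhds_zero (Metric.closedBall_mem_nhds (0 : E) hr) ?_
    refine (Metric.isBounded_closedBall (x := (0 : ℝ)) (r := M)).subset ?_
    rintro _ ⟨p, hp, rfl⟩
    have hp' : ‖p‖ ≤ r := by simpa using hp
    simpa [hG', hGh p hp'] using hM p hp'
  exact ⟨G'.toRealLinearMap hcont, fun p hp => (hGh p hp).symm⟩

section SelfCorrection

variable {E : Type*} [NormedAddCommGroup E] [InnerProductSpace ℝ E] [FiniteDimensional ℝ E]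
  [MeasurableSpace E] [BorelSpace E] {f : E → ℝ}

local notation "γ" => stdGaussian E

instance isProbabilityMeasure_map_const_sub_stdGaussian (p : E) :
    IsProbabilityMeasure (Measure.map (fun x : E => p - x) γ) :=
  Measure.isProbabilityMeasure_map (by fun_prop)

lemma prod_stdGaussian_preimage_le {p q : E} (hp : ‖p‖ ≤ 3 / 100) (hq : ‖q‖ ≤ 3 / 100)
    {A : Set (E × E)} (hA : MeasurableSet A) :
    (Measure.prod γ γ) {w | (p - w.1, q - w.2) ∈ A} ≤
      (Measure.prod γ γ) A + ENNReal.ofReal (2 / 25) := by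
  have h := prod_apply_le_add (fun _ hB => map_const_sub_stdGaussian_apply_le hp hB)
    (fun _ hB => map_const_sub_stdGaussian_apply_le hq hB) hA
  rw [Measure.map_prod_map _ _ (by fun_prop) (by fun_prop), Measure.map_apply (by fun_prop) hA,
    ← ENNReal.ofReal_add (by norm_num) (by norm_num)] at h
  norm_num at h
  exact h

lemma prod_prod_stdGaussian_preimage_le {p q s : E} (hp : ‖p‖ ≤ 3 / 100) (hq : ‖q‖ ≤ 3 / 100)
    (hs : ‖s‖ ≤ 3 / 100) {A : Set (E × E × E)} (hA : MeasurableSet A) :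
    (Measure.prod γ (Measure.prod γ γ)) {w | (p - w.1, q - w.2.1, s - w.2.2) ∈ A} ≤
      (Measure.prod γ (Measure.prod γ γ)) A + ENNReal.ofReal (3 / 25) := by
  have h := prod_apply_le_add (fun _ hB => map_const_sub_stdGaussian_apply_le hp hB)
    (fun _ hC => prod_apply_le_add (fun _ hB => map_const_sub_stdGaussian_apply_le hq hB)
      (fun _ hB => map_const_sub_stdGaussian_apply_le hs hB) hC) hA
  rw [Measure.map_prod_map _ _ (by fun_prop) (by fun_prop),
    Measure.map_prod_map _ _ (by fun_prop) (by fun_prop), Measure.map_apply (by fun_prop) hA,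
    ← ENNReal.ofReal_add (by norm_num) (by norm_num),
    ← ENNReal.ofReal_add (by norm_num) (by norm_num)] at h
  norm_num at h
  exact h

/-- The value of `f (p - x) + f x` is concentrated at one point for short `p`. -/
lemma exists_concentrated (hf : Measurable f)
    (hB : (Measure.prod γ γ) {w | f (w.1 - w.2) ≠ f w.1 - f w.2} ≤ ENNReal.ofReal (1 / 100))
    {p : E} (hp : ‖p‖ ≤ 1 / 50) :
    ∃ c : ℝ, γ {x | f (p - x) + f x ≠ c} ≤ ENNReal.ofReal (1 / 10) := by
  set B : Set (E × E) := {w | f (w.1 - w.2) ≠ f w.1 - f w.2} with hBdef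
  have hBm : MeasurableSet B :=
    (measurableSet_eq_fun (by fun_prop) (by fun_prop)).compl
  set S : Set (E × E) := {w | f (p - w.1) + f w.1 ≠ f (p - w.2) + f w.2} with hSdef
  have hSm : MeasurableSet S := (measurableSet_eq_fun (by fun_prop) (by fun_prop)).compl
  -- If both pairs pass the difference test, then f(p - x) - f(p - y) and f(y) - f(x) both equal f(y
  -- - x), because (p - x) - (p - y) = y - x.
  have hsub : S ⊆ {w | (p - w.1, p - w.2) ∈ B} ∪ Prod.swap ⁻¹' B := by
    rintro ⟨x, y⟩ hw
    by_contra hcon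
    simp only [hBdef, Set.mem_union, Set.mem_ofPred_eq, Set.mem_preimage, Prod.swap, not_or,
      not_not, sub_sub_sub_cancel_left] at hcon
    exact hw (by linarith [hcon.1, hcon.2])
  have hswap : (Measure.prod γ γ) (Prod.swap ⁻¹' B) = (Measure.prod γ γ) B := by
    rw [← Measure.map_apply measurable_swap hBm, Measure.prod_swap]
  have hp' : ‖p‖ ≤ 3 / 100 := hp.trans (by norm_num)
  have hS : (Measure.prod γ γ) S ≤ ENNReal.ofReal (1 / 10) := by
    calc (Measure.prod γ γ) S ≤ _ := measure_mono hsub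
      _ ≤ _ := measure_union_le _ _
      _ ≤ (ENNReal.ofReal (1 / 100) + ENNReal.ofReal (2 / 25)) + ENNReal.ofReal (1 / 100) := by
        rw [hswap]
        gcongr
        exact (prod_stdGaussian_preimage_le hp' hp' hBm).trans (by gcongr)
      _ = ENNReal.ofReal (1 / 10) := by
        rw [← ENNReal.ofReal_add (by norm_num) (by norm_num),
          ← ENNReal.ofReal_add (by norm_num) (by norm_num)]
        norm_num
  rw [Measure.prod_apply_symm hSm] at hS
  -- Some y does at least as well as the average; its value f(p - y) + f(y) serves as the point of
  -- concentration.
  obtain ⟨y, hy⟩ := exists_le_lintegral (μ := γ)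
    (f := fun y => γ ((fun x => (x, y)) ⁻¹' S)) (measurable_measure_prodMk_right hSm).aemeasurable
  exact ⟨f (p - y) + f y, hy.trans hS⟩

/-- A bad set of measure less than one has a good point in its complement. -/
lemma exists_notMem_of_measure_lt_one {X : Type*} [MeasurableSpace X] {μ : Measure X}
    [IsProbabilityMeasure μ] {s : Set X} (hs : μ s < 1) : ∃ x, x ∉ s := by
  by_contra! h
  rw [Set.eq_univ_of_forall h, measure_univ] at hs
  exact lt_irrefl _ hs

/-- Normalized differences of two out of three independent standard Gaussians are standard
Gaussians. -/
lemma measurePreserving_marginals :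
    MeasurePreserving (fun w : E × E × E => (√2)⁻¹ • (w.1 - w.2.1))
      (Measure.prod γ (Measure.prod γ γ)) γ ∧
    MeasurePreserving (fun w : E × E × E => (√2)⁻¹ • (w.1 - w.2.2))
      (Measure.prod γ (Measure.prod γ γ)) γ ∧
    MeasurePreserving (fun w : E × E × E => (√2)⁻¹ • (w.2.2 - w.2.1))
      (Measure.prod γ (Measure.prod γ γ)) γ := by
  have h : MeasurePreserving (fun z : E × E => (√2)⁻¹ • (z.1 - z.2)) (Measure.prod γ γ) γ :=
    ⟨by fun_prop, map_sub_stdGaussian⟩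
  refine ⟨h.comp ((MeasurePreserving.id _).prod measurePreserving_fst),
    h.comp ((MeasurePreserving.id _).prod measurePreserving_snd),
    h.comp (Measure.measurePreserving_swap.comp measurePreserving_snd)⟩

/-- Put u = (x - z)/√2 and v = (z - y)/√2, so that u + v = (x - y)/√2; each of the three is a
standard Gaussian. For a common good triple, f(u + v) = f(u) + f(v) and f(p + q - u - v) = f(p - u)
+ f(q - v), and adding these gives c = a + b. The values a, b, c may be any points of concentration,
so uniqueness of these points is not required. -/
lemma concentrated_add (hf : Measurable f)
    (hC : (Measure.prod γ (Measure.prod γ γ)) {w | f ((√2)⁻¹ • (w.1 - w.2.1)) ≠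
      f ((√2)⁻¹ • (w.1 - w.2.2)) + f ((√2)⁻¹ • (w.2.2 - w.2.1))} ≤ ENNReal.ofReal (1 / 100))
    {p q : E} (hp : ‖p‖ ≤ 1 / 50) (hq : ‖q‖ ≤ 1 / 50) {a b c : ℝ}
    (ha : γ {x | f (p - x) + f x ≠ a} ≤ ENNReal.ofReal (1 / 10))
    (hb : γ {x | f (q - x) + f x ≠ b} ≤ ENNReal.ofReal (1 / 10))
    (hc : γ {x | f (p + q - x) + f x ≠ c} ≤ ENNReal.ofReal (1 / 10)) : c = a + b := by
  set C : Set (E × E × E) := {w | f ((√2)⁻¹ • (w.1 - w.2.1)) ≠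
      f ((√2)⁻¹ • (w.1 - w.2.2)) + f ((√2)⁻¹ • (w.2.2 - w.2.1))} with hCdef
  have hCm : MeasurableSet C := (measurableSet_eq_fun (by fun_prop) (by fun_prop)).compl
  have hm : ∀ (v : E) (d : ℝ), MeasurableSet {x | f (v - x) + f x ≠ d} := fun v d =>
    (measurableSet_eq_fun (by fun_prop) (by fun_prop)).compl
  obtain ⟨m1, m2, m3⟩ := measurePreserving_marginals (E := E)
  have hs2 : (0 : ℝ) < √2 := by positivity
  have hnorm : ∀ v : E, ‖v‖ ≤ 1 / 50 → ‖√2 • v‖ ≤ 3 / 100 := by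
    intro v hv
    rw [norm_smul, Real.norm_of_nonneg hs2.le]
    have : √2 ≤ 3 / 2 := Real.sqrt_le_iff.2 ⟨by norm_num, by norm_num⟩
    nlinarith [norm_nonneg v]
  -- Replacing (x, y, z) by (√2 p - x, -√2 q - y, -z) turns u and v into p - u and q - v.
  have hshift := prod_prod_stdGaussian_preimage_le (hnorm p hp)
    (q := -(√2 • q)) (by rw [norm_neg]; exact hnorm q hq) (s := (0 : E)) (by norm_num) hCm
  have hbad : (Measure.prod γ (Measure.prod γ γ))
      ((((fun w : E × E × E => (√2)⁻¹ • (w.1 - w.2.2)) ⁻¹' {x | f (p - x) + f x ≠ a} ∪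
      (fun w : E × E × E => (√2)⁻¹ • (w.2.2 - w.2.1)) ⁻¹' {x | f (q - x) + f x ≠ b}) ∪
      (fun w : E × E × E => (√2)⁻¹ • (w.1 - w.2.1)) ⁻¹' {x | f (p + q - x) + f x ≠ c}) ∪
      (C ∪ {w | (√2 • p - w.1, -(√2 • q) - w.2.1, 0 - w.2.2) ∈ C})) < 1 := by
    refine (measure_union_le _ _).trans_lt ((add_le_add ((measure_union_le _ _).trans
      (add_le_add (measure_union_le _ _) le_rfl)) (measure_union_le _ _)).trans_lt ?_)
    rw [m1.measure_preimage (hm _ _).nullMeasurableSet,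
      m2.measure_preimage (hm _ _).nullMeasurableSet,
      m3.measure_preimage (hm _ _).nullMeasurableSet]
    -- The failure probabilities sum to 0.3 + 0.02 + 0.12 = 0.44, so a triple avoiding all the bad
    -- events exists.
    calc _ ≤ ENNReal.ofReal (1 / 10) + ENNReal.ofReal (1 / 10) + ENNReal.ofReal (1 / 10) +
          (ENNReal.ofReal (1 / 100) + (ENNReal.ofReal (1 / 100) + ENNReal.ofReal (3 / 25))) := by
          gcongr
          exact hshift.trans (by gcongr)
      _ < 1 := by
        rw [← ENNReal.ofReal_add, ← ENNReal.ofReal_add, ← ENNReal.ofReal_add, ← ENNReal.ofReal_add,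
          ← ENNReal.ofReal_add, ENNReal.ofReal_lt_one] <;> norm_num
  obtain ⟨⟨x, y, z⟩, hw⟩ := exists_notMem_of_measure_lt_one hbad
  simp only [hCdef, Set.mem_union, Set.mem_preimage, Set.mem_ofPred_eq, not_or, not_not] at hw
  obtain ⟨⟨⟨w1, w2⟩, w3⟩, w4, w5⟩ := hw
  have e1 : (√2)⁻¹ • (√2 • p - x - (0 - z)) = p - (√2)⁻¹ • (x - z) := by
    simp only [smul_sub, inv_smul_smul₀ hs2.ne', smul_zero]; abel
  have e2 : (√2)⁻¹ • (0 - z - (-(√2 • q) - y)) = q - (√2)⁻¹ • (z - y) := by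
    simp only [smul_sub, smul_neg, inv_smul_smul₀ hs2.ne', smul_zero]; abel
  have e3 : (√2)⁻¹ • (√2 • p - x - (-(√2 • q) - y)) = p + q - (√2)⁻¹ • (x - y) := by
    simp only [smul_sub, smul_neg, inv_smul_smul₀ hs2.ne']; abel
  rw [e1, e2, e3] at w5
  linarith

/-- Choose k with |f| ≤ k outside Gaussian measure 1/10. For every short p some x satisfies this at
both x and p - x while also attaining c, hence |c| ≤ 2k. The bound is uniform in p because the shift
estimate is. -/
lemma exists_bound_concentrated (hf : Measurable f) :
    ∃ M : ℝ, ∀ p : E, ‖p‖ ≤ 1 / 50 → ∀ c : ℝ,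
      γ {x | f (p - x) + f x ≠ c} ≤ ENNReal.ofReal (1 / 10) → |c| ≤ M := by
  have hm : ∀ k : ℕ, MeasurableSet {x | (k : ℝ) < |f x|} := fun k =>
    measurableSet_lt measurable_const (by fun_prop)
  obtain ⟨k, hk⟩ : ∃ k : ℕ, γ {x | (k : ℝ) < |f x|} ≤ ENNReal.ofReal (1 / 10) := by
    have ht := tendsto_measure_iInter_atTop (μ := γ) (s := fun k : ℕ => {x | (k : ℝ) < |f x|})
      (fun k => (hm k).nullMeasurableSet)
      (fun i j hij x (hx : (j : ℝ) < |f x|) =>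
        lt_of_le_of_lt (Nat.cast_le.2 hij) hx) ⟨0, measure_ne_top _ _⟩
    have hempty : ⋂ k : ℕ, {x | (k : ℝ) < |f x|} = ∅ := by
      ext x
      simp only [Set.mem_iInter, Set.mem_ofPred_eq, Set.mem_empty_iff_false, iff_false, not_forall,
        not_lt]
      exact exists_nat_ge _
    rw [hempty, measure_empty] at ht
    exact (ht.eventually_le_const (by simp)).exists
  refine ⟨2 * k, fun p hp c hc => ?_⟩
  have hshift := map_const_sub_stdGaussian_apply_le (p := p) (hp.trans (by norm_num)) (hm k)
  rw [Measure.map_apply (by fun_prop) (hm k)] at hshift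
  have hbad : γ ({x | f (p - x) + f x ≠ c} ∪ ({x | (k : ℝ) < |f x|} ∪
      (fun x => p - x) ⁻¹' {x | (k : ℝ) < |f x|})) < 1 := by
    calc _ ≤ _ := (measure_union_le _ _).trans (add_le_add le_rfl (measure_union_le _ _))
      _ ≤ ENNReal.ofReal (1 / 10) + (ENNReal.ofReal (1 / 10) +
          (ENNReal.ofReal (1 / 10) + ENNReal.ofReal (1 / 25))) := by
        gcongr
        exact hshift.trans (by gcongr)
      _ < 1 := by
        rw [← ENNReal.ofReal_add, ← ENNReal.ofReal_add, ← ENNReal.ofReal_add,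
          ENNReal.ofReal_lt_one] <;> norm_num
  obtain ⟨x, hx⟩ := exists_notMem_of_measure_lt_one hbad
  simp only [Set.mem_union, Set.mem_preimage, Set.mem_ofPred_eq, not_or, not_not, not_lt] at hx
  obtain ⟨h1, h2, h3⟩ := hx
  rw [← h1]
  linarith [abs_add_le (f (p - x)) (f x)]

/-- If a round of the additivity subroutine rarely rejects `f`, then near the origin `f` is
self-corrected to a linear functional. -/
lemma exists_linear_selfCorrection (hf : Measurable f)
    (hB : (Measure.prod γ γ) {w | f (w.1 - w.2) ≠ f w.1 - f w.2} ≤ ENNReal.ofReal (1 / 100))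
    (hC : (Measure.prod γ (Measure.prod γ γ)) {w | f ((√2)⁻¹ • (w.1 - w.2.1)) ≠
      f ((√2)⁻¹ • (w.1 - w.2.2)) + f ((√2)⁻¹ • (w.2.2 - w.2.1))} ≤ ENNReal.ofReal (1 / 100)) :
    ∃ L : E →L[ℝ] ℝ, ∀ p : E, ‖p‖ ≤ 1 / 50 →
      γ {x | f (p - x) + f x ≠ L p} ≤ ENNReal.ofReal (1 / 10) := by
  have hex : ∀ p : E, ∃ c : ℝ, ‖p‖ ≤ 1 / 50 →
      γ {x | f (p - x) + f x ≠ c} ≤ ENNReal.ofReal (1 / 10) := fun p => by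
    by_cases hp : ‖p‖ ≤ 1 / 50
    · obtain ⟨c, hc⟩ := exists_concentrated hf hB hp
      exact ⟨c, fun _ => hc⟩
    · exact ⟨0, fun h => absurd h hp⟩
  choose h hh using hex
  obtain ⟨M, hM⟩ := exists_bound_concentrated hf
  obtain ⟨L, hL⟩ := exists_continuousLinearMap_eq_of_additive_on_ball (r := 1 / 50) (by norm_num)
    (h := h) (fun p q hp hq hpq => concentrated_add hf hC hp hq (hh p hp) (hh q hq) (hh _ hpq))
    (M := M) (fun p hp => hM p hp _ (hh p hp))
  exact ⟨L, fun p hp => hL p hp ▸ hh p hp⟩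

end SelfCorrection

/-! ### The tester -/

section Tester

open QueryAlg

variable {n : ℕ} {f : RealSpace n → ℝ} {D : Measure (RealSpace n)}

/-- Automatic continuity of measurable homomorphisms. It lets additivity and linearity share one
completeness argument. -/
lemma exists_continuousLinearMap_of_mem_additiveFunctions (hf : f ∈ additiveFunctions n) :
    ∃ L : RealSpace n →L[ℝ] ℝ, ∀ x, f x = L x := by
  set g : RealSpace n →+ ℝ := AddMonoidHom.mk' f fun x y => (hf.2 x y).symm
  have hg : Continuous g := MeasureTheory.Measure.AddMonoidHom.continuous_of_measurable g hf.1
  exact ⟨g.toRealLinearMap hg, fun _ => rfl⟩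

lemma coe_mem_additiveFunctions (L : RealSpace n →L[ℝ] ℝ) : ⇑L ∈ additiveFunctions n :=
  ⟨L.continuous.measurable, fun x y => (map_add L x y).symm⟩

lemma coe_mem_linearFunctions (L : RealSpace n →L[ℝ] ℝ) : ⇑L ∈ linearFunctions n := by
  refine ⟨fun i => L (EuclideanSpace.single i 1), fun x => ?_⟩
  conv_lhs => rw [← (EuclideanSpace.basisFun (Fin n) ℝ).sum_repr x]
  simp [mul_comm]

lemma linearFunctions_subset_additiveFunctions : linearFunctions n ⊆ additiveFunctions n := by
  rintro g ⟨c, hc⟩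
  obtain rfl : g = fun x => ∑ i, c i * x i := funext hc
  refine ⟨by fun_prop, fun x y => ?_⟩
  simp [mul_add, Finset.sum_add_distrib]

lemma contractionFactor_pos (p : RealSpace n) : 0 < contractionFactor p := by
  unfold contractionFactor
  split_ifs with h
  · exact one_pos
  · linarith

lemma norm_inv_contractionFactor_smul_le (p : RealSpace n) :
    ‖(contractionFactor p)⁻¹ • p‖ ≤ 1 / 50 := by
  rw [norm_smul, norm_inv, Real.norm_of_nonneg (contractionFactor_pos p).le,
    inv_mul_le_iff₀ (contractionFactor_pos p)]
  unfold contractionFactor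
  split_ifs with h <;> linarith

/-- The tester accepts every additive measurable function with probability one. -/
lemma prob_true_singleDirectionTester_of_additive [IsProbabilityMeasure D]
    (hf : f ∈ additiveFunctions n) (N M : ℕ) :
    (singleDirectionTester n N M).prob f D true = 1 := by
  obtain ⟨L, hL⟩ := exists_continuousLinearMap_of_mem_additiveFunctions hf
  have ha := isMeasurable_additivityRound (D := D) hf.1
  have hc := isMeasurable_correctionRound (D := D) hf.1
  have h1 : (additivityRound (n := n)).prob f D false = 0 := by
    rw [prob_false_additivityRound hf.1]
    refine (congrArg _ ?_).trans measure_empty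
    rw [Set.compl_empty_iff, Set.eq_univ_iff_forall]
    rintro ⟨x, y, z⟩
    refine ⟨?_, ?_, ?_⟩ <;> simp only [hL, map_neg, map_sub, map_smul, smul_eq_mul]
    ring
  have h2 : (correctionRound (n := n)).prob f D false = 0 := by
    rw [prob_false_correctionRound hf.1]
    refine (lintegral_congr fun p => ?_).trans lintegral_zero
    refine (congrArg _ ?_).trans measure_empty
    rw [Set.eq_empty_iff_forall_notMem]
    rintro x hx
    have hκ := (contractionFactor_pos p).ne'
    refine hx ?_
    simp only [hL, map_sub, map_smul, smul_eq_mul, sub_add_cancel]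
    rw [mul_inv_cancel_left₀ hκ]
  have h1' := prob_true_add_prob_false _ ha
  have h2' := prob_true_add_prob_false _ hc
  rw [h1, add_zero] at h1'
  rw [h2, add_zero] at h2'
  rw [prob_true_singleDirectionTester ha hc, h1', h2', one_pow, one_pow, one_mul]

/-- If the additivity subroutine rarely rejects, then `f` has a linear self-correction. -/
lemma exists_linear_of_prob_additivityRound_le (hf : Measurable f)
    (h : (additivityRound (n := n)).prob f D false ≤ ENNReal.ofReal (1 / 100)) :
    ∃ L : RealSpace n →L[ℝ] ℝ, ∀ p, ‖p‖ ≤ 1 / 50 →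
      stdGaussian (RealSpace n) {x | f (p - x) + f x ≠ L p} ≤ ENNReal.ofReal (1 / 10) := by
  rw [prob_false_additivityRound hf] at h
  refine exists_linear_selfCorrection hf ?_ ((measure_mono ?_).trans h)
  · have hm : MeasurePreserving (fun w : RealSpace n × RealSpace n × RealSpace n => (w.1, w.2.1))
        ((stdGaussian (RealSpace n)).prod
          ((stdGaussian (RealSpace n)).prod (stdGaussian (RealSpace n))))
        ((stdGaussian (RealSpace n)).prod (stdGaussian (RealSpace n))) :=
      (MeasurePreserving.id _).prod measurePreserving_fst
    have hB : MeasurableSet {w : RealSpace n × RealSpace n | f (w.1 - w.2) ≠ f w.1 - f w.2} :=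
      (measurableSet_eq_fun (by fun_prop) (by fun_prop)).compl
    rw [← hm.measure_preimage hB.nullMeasurableSet]
    refine (measure_mono fun w hw hw' => ?_).trans h
    exact hw hw'.2.1
  · exact fun w hw hw' => hw hw'.2.2

/-- A comparison round rejects with probability at least half the probability that `f` differs
from its linear self-correction. -/
lemma le_prob_false_correctionRound (hf : Measurable f) {L : RealSpace n →L[ℝ] ℝ}
    (hL : ∀ p, ‖p‖ ≤ 1 / 50 →
      stdGaussian (RealSpace n) {x | f (p - x) + f x ≠ L p} ≤ ENNReal.ofReal (1 / 10)) :
    ENNReal.ofReal (1 / 2) * D {x | f x ≠ L x} ≤ (correctionRound (n := n)).prob f D false := by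
  have hS : MeasurableSet {x | f x ≠ L x} :=
    (measurableSet_eq_fun hf L.continuous.measurable).compl
  rw [prob_false_correctionRound hf, ← lintegral_indicator_const hS]
  refine lintegral_mono fun p => ?_
  dsimp only
  by_cases hp : f p = L p
  · rw [Set.indicator_of_notMem (by simpa using hp)]
    exact zero_le
  rw [Set.indicator_of_mem (by simpa using hp)]
  have hκ := (contractionFactor_pos p).ne'
  set q := (contractionFactor p)⁻¹ • p with hq
  set A := {x | f p ≠ contractionFactor p * (f (q - x) + f x)} with hA
  -- By linearity κ_p · L(p/κ_p) = L(p) ≠ f(p), so a comparison at p can accept only when the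
  -- direction x gives a wrong value for L(p/κ_p).
  have hcover : Aᶜ ⊆ {x | f (q - x) + f x ≠ L q} := by
    intro x hx hxL
    have h1 : f p = contractionFactor p * (f (q - x) + f x) := by simpa [hA] using hx
    apply hp
    rw [h1, hxL, hq, map_smul, smul_eq_mul, mul_inv_cancel_left₀ hκ]
  have h1 : (1 : ℝ≥0∞) ≤ stdGaussian (RealSpace n) A + ENNReal.ofReal (1 / 10) := by
    calc (1 : ℝ≥0∞) = stdGaussian (RealSpace n) (A ∪ Aᶜ) := by simp
      _ ≤ _ := measure_union_le _ _
      _ ≤ _ := by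
        gcongr
        exact (measure_mono hcover).trans (hL q (norm_inv_contractionFactor_smul_le p))
  -- The available rejection probability 9/10 is weakened to 1/2.
  have h2 : ENNReal.ofReal (1 / 2) + ENNReal.ofReal (1 / 10) ≤
      stdGaussian (RealSpace n) A + ENNReal.ofReal (1 / 10) := by
    refine le_trans ?_ h1
    rw [← ENNReal.ofReal_add (by norm_num) (by norm_num), ENNReal.ofReal_le_one]
    norm_num
  exact (ENNReal.add_le_add_iff_right ENNReal.ofReal_ne_top).1 h2

/-- If one of `k` rounds rejects with probability at least `t`, where `2 ≤ k * t`, then all of them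
accept with probability at most `1 / 3`. -/
lemma pow_le_third {a b : ℝ≥0∞} (hab : a + b = 1) {t : ℝ} (ht : 0 ≤ t) (hb : ENNReal.ofReal t ≤ b)
    {k : ℕ} (hk : 2 ≤ k * t) : a ^ k ≤ ENNReal.ofReal (1 / 3) := by
  have hbtop : b ≤ 1 := hab ▸ le_add_self
  have ht1 : t ≤ 1 := ENNReal.ofReal_le_one.1 (hb.trans hbtop)
  have ha : a ≤ ENNReal.ofReal (1 - t) := by
    refine (ENNReal.add_le_add_iff_right (ENNReal.ofReal_ne_top (r := t))).1 ?_
    rw [← ENNReal.ofReal_add (by linarith) ht, sub_add_cancel, ENNReal.ofReal_one, ← hab]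
    gcongr
  calc a ^ k ≤ ENNReal.ofReal (1 - t) ^ k := by gcongr
    _ = ENNReal.ofReal ((1 - t) ^ k) := (ENNReal.ofReal_pow (by linarith) k).symm
    _ ≤ ENNReal.ofReal (1 / 3) := by
      apply ENNReal.ofReal_le_ofReal
      calc (1 - t) ^ k ≤ Real.exp (-t) ^ k :=
            pow_le_pow_left₀ (by linarith) (Real.one_sub_le_exp_neg t) k
        _ = Real.exp (-(k * t)) := by rw [← Real.exp_nat_mul]; ring_nf
        _ ≤ Real.exp (-2) := Real.exp_le_exp.2 (by linarith)
        _ ≤ 1 / 3 := by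
          rw [Real.exp_neg, one_div]
          gcongr
          -- This is exp(2) ≥ 2 + 1 = 3.
          linarith [Real.add_one_le_exp 2]

/-- The two cases are separated by the rejection probability 1/100 of an additivity round. The
numbers of rounds are chosen so that rounds times rejection probability is at least 2 in either
case: 200 · (1/100) = 2, or M · (ε/2) ≥ 2 from M ≥ 4/ε. Only the membership of all continuous linear
functionals in `P` matters, since the distance to `P` is then at most the distance to L. -/
lemma prob_false_singleDirectionTester_of_far [IsProbabilityMeasure D] (hf : Measurable f)
    {P : Set (RealSpace n → ℝ)} (hP : ∀ L : RealSpace n →L[ℝ] ℝ, ⇑L ∈ P) {ε : ℝ} (hε : 0 < ε)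
    (hfar : ENNReal.ofReal ε < distToProperty D f P) {M : ℕ} (hM : 4 / ε ≤ M) :
    2 / 3 ≤ (singleDirectionTester n 200 M).prob f D false := by
  have ha := isMeasurable_additivityRound (D := D) hf
  have hc := isMeasurable_correctionRound (D := D) hf
  have ha1 := prob_true_add_prob_false _ ha
  have hc1 := prob_true_add_prob_false _ hc
  have hT := prob_true_add_prob_false _ (IsMeasurable.singleDirectionTester ha hc 200 M)
  have key : (singleDirectionTester n 200 M).prob f D true ≤ ENNReal.ofReal (1 / 3) := by
    rw [prob_true_singleDirectionTester ha hc]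
    have hale : (additivityRound (n := n)).prob f D true ≤ 1 := ha1 ▸ le_self_add
    have hcle : (correctionRound (n := n)).prob f D true ≤ 1 := hc1 ▸ le_self_add
    rcases le_total ((additivityRound (n := n)).prob f D false) (ENNReal.ofReal (1 / 100))
      with h | h
    · obtain ⟨L, hL⟩ := exists_linear_of_prob_additivityRound_le hf h
      have hD : ENNReal.ofReal ε ≤ D {x | f x ≠ L x} :=
        hfar.le.trans (iInf₂_le (⇑L) (hP L))
      have hrej : ENNReal.ofReal (ε / 2) ≤ (correctionRound (n := n)).prob f D false := by
        refine le_trans ?_ (le_prob_false_correctionRound hf hL)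
        rw [div_eq_inv_mul, ← one_div, ENNReal.ofReal_mul (by norm_num)]
        gcongr
      calc _ ≤ 1 * (correctionRound (n := n)).prob f D true ^ M :=
            mul_le_mul_left (pow_le_one' hale _) _
        _ ≤ _ := by
          rw [one_mul]
          refine pow_le_third hc1 (by positivity) hrej ?_
          rw [div_le_iff₀ hε] at hM
          linarith
    · calc _ ≤ (additivityRound (n := n)).prob f D true ^ 200 * 1 :=
            mul_le_mul_right (pow_le_one' hcle _) _
        _ ≤ _ := by
          rw [mul_one]
          exact pow_le_third ha1 (by norm_num) h (by norm_num)
  have h3 : (2 / 3 : ℝ≥0∞) + ENNReal.ofReal (1 / 3) = 1 := by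
    have : (2 / 3 : ℝ≥0∞) = ENNReal.ofReal (2 / 3) := by
      rw [ENNReal.ofReal_div_of_pos (by norm_num)]
      norm_num
    rw [this, ← ENNReal.ofReal_add (by norm_num) (by norm_num)]
    norm_num
  refine (ENNReal.add_le_add_iff_right (ENNReal.ofReal_ne_top (r := 1 / 3))).1 ?_
  rw [h3, ← hT, add_comm]
  gcongr

/-- Stated for any property lying between the continuous linear functionals and the additive
measurable functions, so that both halves of the theorem are instances. -/
lemma isDistributionFreeTester_singleDirectionTester {F P : Set (RealSpace n → ℝ)}
    (hF : ∀ f ∈ F, Measurable f) (hPa : P ⊆ additiveFunctions n)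
    (hP : ∀ L : RealSpace n →L[ℝ] ℝ, ⇑L ∈ P) {ε : ℝ} (hε : 0 < ε) :
    IsDistributionFreeTester (singleDirectionTester n 200 ⌈4 / ε⌉₊) F P ε ∧
      HasOneSidedError (singleDirectionTester n 200 ⌈4 / ε⌉₊) F P where
  left :=
    { complete := fun D _ f _ hf => by
        rw [prob_true_singleDirectionTester_of_additive (hPa hf)]
        exact ENNReal.div_le_of_le_mul (by norm_num)
      sound := fun D _ f hf hfar =>
        prob_false_singleDirectionTester_of_far (hF f hf) hP hε hfar (Nat.le_ceil _) }
  right := fun D _ _ _ hf => prob_true_singleDirectionTester_of_additive (hPa hf) _ _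

end Tester

end

/-- There are absolute constants `N`, `K`, `C` such that for all `n` and `ε ∈ (0,1)` the tester with
`N` additivity rounds and `⌈K/ε⌉` comparison rounds, each of which evaluates the self-corrected
function with a single Gaussian direction, makes at most `C/ε` queries and is a distribution-free
tester with one-sided error for additivity of (measurable) functions, and also for linearity of
continuous functions. -/
theorem theorem1p3 :
    ∃ (N : ℕ) (K C : ℝ), ∀ (n : ℕ) (ε : ℝ), 0 < ε → ε < 1 →
      (∃ q : ℕ, (singleDirectionTester n N ⌈K / ε⌉₊).queryComplexity ≤ (q : ℕ∞) ∧
        (q : ℝ) ≤ C / ε) ∧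
      (IsDistributionFreeTester (singleDirectionTester n N ⌈K / ε⌉₊)
          {f | Measurable f} (additiveFunctions n) ε ∧
        HasOneSidedError (singleDirectionTester n N ⌈K / ε⌉₊)
          {f | Measurable f} (additiveFunctions n)) ∧
      (IsDistributionFreeTester (singleDirectionTester n N ⌈K / ε⌉₊)
          {f | Continuous f} (linearFunctions n) ε ∧
        HasOneSidedError (singleDirectionTester n N ⌈K / ε⌉₊)
          {f | Continuous f} (linearFunctions n)) := by
  -- The query count is at most 7 · 200 + 3 · (4/ε + 1) = 1403 + 12/ε, which is at most 1415/ε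
  -- because 1 ≤ 1/ε.
  refine ⟨200, 4, 1415, fun n ε hε hε1 => ⟨⟨_, QueryAlg.queryComplexity_singleDirectionTester_le _ _, ?_⟩,
    isDistributionFreeTester_singleDirectionTester (fun _ hf => hf) subset_rfl
      coe_mem_additiveFunctions hε,
    isDistributionFreeTester_singleDirectionTester (fun _ hf => Continuous.measurable hf)
      linearFunctions_subset_additiveFunctions coe_mem_linearFunctions hε⟩⟩
  have hceil : (⌈4 / ε⌉₊ : ℝ) ≤ 4 / ε + 1 := (Nat.ceil_lt_add_one (by positivity)).le
  have hinv : 1 ≤ 1 / ε := by rw [le_div_iff₀ hε]; linarith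
  have e4 : 4 / ε = 4 * (1 / ε) := by ring
  have e : 1415 / ε = 1415 * (1 / ε) := by ring
  push_cast
  rw [e]
  have hceil' : (⌈4 / ε⌉₊ : ℝ) ≤ 4 * (1 / ε) + 1 := by rwa [← e4]
  linarith
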